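/- Let $R$ be a right noetherian ring (associative with unit) and let $F$ be an indecomposable injective right $R$-module (in particular $F\neq 0$). For a right $R$-module $M$ and a cardinal $\kappa$, say that $M$ has $F$-rank $\kappa$ if $M=M_1\oplus M_2$ with $M_1\cong F^{(\kappa)}$ and $M_2$ without direct summands isomorphic to $F$. Let $\mathbf C_F$ be the full subcategory of $\mathrm{Mod}\text{-}R$ whose objects are the modules of finite $F$-rank. For objects $A,B$ of a preadditive category $\mathbf C$ write $A\prec B$ if there is an infinite set $E\subseteq \mathrm{Hom}_{\mathbf C}(B,A)\times\mathrm{Hom}_{\mathbf C}(A,B)$ such that $fg=1_A$ for every $(f,g)\in E$ and $|\{(f,g)\in E: f\varphi\neq 0\}|<|E|$ for every $\varphi\in\mathrm{Hom}_{\mathbf C}(A,B)$. Let $\mathbf M(\mathbf C)$ be the class of all objects $C$ of $\mathbf C$ for which there is no object $A$ of $\mathbf C$ with $C\prec A$, and let $\mathbf S(\mathbf C)$ be the class of all objects $C$ of $\mathbf C$ for which there is $A\in\mathbf M(\mathbf C)$ with $C\prec A$. Then: (1) $\mathbf M(\mathbf C_F)$ consists exactly of the modules $M\in\mathbf C_F$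 of positive $F$-rank together with the zero modules; (2) $\mathbf S(\mathbf C_F)$ consists exactly of the non-zero modules $M\in\mathbf C_F$ of $F$-rank $0$. -/

import Mathlib

open CategoryTheory CategoryTheory.Limits

universe v u

section PreadditiveOrder

variable {C : Type u} [Category.{v} C] [Preadditive C]

/-- The strict order `A ≺ B` on the objects of a preadditive category: there is an infinite set
`E` of pairs `(f, g)` with `f : B ⟶ A`, `g : A ⟶ B` such that `f ∘ g = 1_A` for every
`(f, g) ∈ E` and such that, for each `φ : A ⟶ B`, strictly fewer than `|E|` of these pairs
satisfy `f ∘ φ ≠ 0`. -/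
def Prec (A B : C) : Prop :=
  ∃ E : Set ((B ⟶ A) × (A ⟶ B)), E.Infinite ∧
    (∀ p ∈ E, p.2 ≫ p.1 = 𝟙 A) ∧
    ∀ φ : A ⟶ B, Cardinal.mk {p : (B ⟶ A) × (A ⟶ B) // p ∈ E ∧ φ ≫ p.1 ≠ 0} < Cardinal.mk E

variable (C) in
/-- The objects of the full subcategory `M(C)`: there is no `A` in `C` with `X ≺ A`. -/
def maximalObjects : ObjectProperty C :=
  fun X => ¬ ∃ A : C, Prec X A

variable (C) in
/-- The objects of the full subcategory `S(C)`: there is `A` in `M(C)` with `X ≺ A`. -/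
def belowMaximalObjects : ObjectProperty C :=
  fun X => ∃ A : C, maximalObjects C A ∧ Prec X A

end PreadditiveOrder

section Rank

variable {R : Type u} [Ring R]

/-- The right `R`-module `M` (a module over `Rᵐᵒᵖ`) has `F`-rank `κ`: it is an internal direct
sum `M = M₁ ⊕ M₂`, where `M₁` is isomorphic to the direct sum `F^(κ)` of `κ` copies of `F`
and no direct summand of `M₂` is isomorphic to `F`. -/
def HasRank (F M : ModuleCat.{v} Rᵐᵒᵖ) (κ : Cardinal.{v}) : Prop :=
  ∃ M₁ M₂ : Submodule Rᵐᵒᵖ M, IsCompl M₁ M₂ ∧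
    Nonempty (M₁ ≃ₗ[Rᵐᵒᵖ] (κ.out →₀ F)) ∧
    ∀ N N' : Submodule Rᵐᵒᵖ M₂, IsCompl N N' → IsEmpty (N ≃ₗ[Rᵐᵒᵖ] F)

/-- The modules of finite `F`-rank. -/
def HasFiniteRank (F : ModuleCat.{v} Rᵐᵒᵖ) : ObjectProperty (ModuleCat.{v} Rᵐᵒᵖ) :=
  fun M => ∃ κ : Cardinal.{v}, κ < Cardinal.aleph0 ∧ HasRank F M κ

/-- The full subcategory `C_F` of `Mod-R` whose objects are the modules of finite `F`-rank. -/
abbrev FiniteRankCat (F : ModuleCat.{v} Rᵐᵒᵖ) := (HasFiniteRank F).FullSubcategory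

end Rank

/-!
Over any ring, an indecomposable injective module `F` is uniform: two nonzero submodules of `F`
always meet, since disjoint submodules can be enlarged to complementary ones
(`Submodule.exists_isCompl_of_disjoint`). As `F` is injective, a module has a direct summand
isomorphic to `F` if and only if `F` embeds in it (`isEmpty_summand_equiv_iff`), so having
`F`-rank `0` means that `F` does not embed.

A module of positive rank is maximal: let `M` contain `F` as a summand, let `A = A₁ ⊕ A₂` with
`A₁` a finite power of `F` and no copy of `F` inside `A₂`, and let `f ∘ g = 1_M` with `g : M → A`.
If `f` killed `A₁`, it would factor through `A₂`, and the component `M → A₂` of `g` would embed `F`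
into `A₂`. Hence `f` is nonzero on one of the finitely many summands `F` of `A₁`, and the
corresponding maps `M → F → A` show that an infinite set `E` of such pairs is a finite union of
sets of smaller cardinality (`not_prec_of_injective`).

A nonzero module `M` of rank `0` lies below `F × M^(I)` for every large set `I`, through the
coordinate injections and projections of `M^(I)`: a map out of `M` meets at most `|M| · ℵ₀` of the
coordinates (`exists_prec_of_hasRank_zero`). This module has rank `1`, because `F` does not embed
in `M^(I)`: on the submodule generated by a nonzero element of `F` finitely many coordinates
already separate points, so by uniformity one coordinate map `F → M` is injective
(`exists_injective_of_injective_finsupp`).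
-/

/-! ### Indecomposable injective modules are uniform -/

section Uniform

variable {S : Type u} [Ring S]

/-- Among the submodules disjoint from `K`, there is a maximal one above any given one. -/
theorem Submodule.exists_le_maximal_disjoint {F : Type v} [AddCommGroup F] [Module S F]
    {N K : Submodule S F} (h : Disjoint N K) :
    ∃ L, N ≤ L ∧ Maximal (fun P : Submodule S F => Disjoint P K) L := by
  refine zorn_le_nonempty₀ {P : Submodule S F | Disjoint P K} (fun c hc hchain y hy => ?_) N h
  refine ⟨sSup c, ?_, fun z hz => le_sSup hz⟩
  exact hchain.directedOn.disjoint_sSup_left.2 fun P hP => hc hP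

/-- Disjoint submodules of an injective module can be enlarged to complementary submodules. -/
theorem Submodule.exists_isCompl_of_disjoint {F : Type v} [AddCommGroup F] [Module S F]
    [Module.Injective S F] {N N' : Submodule S F} (h : Disjoint N N') :
    ∃ L K : Submodule S F, N ≤ L ∧ N' ≤ K ∧ IsCompl L K := by
  obtain ⟨K, hN'K, hK⟩ := Submodule.exists_le_maximal_disjoint h.symm
  obtain ⟨L, hNL, hL⟩ := Submodule.exists_le_maximal_disjoint hK.prop.symm
  have hinj : Function.Injective (L.subtype.coprod K.subtype) := by
    rw [← LinearMap.ker_eq_bot, LinearMap.ker_coprod_of_disjoint_range]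
    · simp
    · simpa using hL.prop
  -- `p` extends the projection `L ⊕ K → L` to an endomorphism of the whole module.
  obtain ⟨p, hp⟩ := Module.Injective.out (L.subtype.coprod K.subtype) hinj
    (L.subtype ∘ₗ LinearMap.fst S L K)
  have hpL : ∀ x ∈ L, p x = x := fun x hx => by simpa using hp (⟨x, hx⟩, 0)
  have hpK : ∀ x ∈ K, p x = 0 := fun x hx => by simpa using hp (0, ⟨x, hx⟩)
  have hcomap : K.comap p ≤ K := by
    refine hK.le_of_ge (Disjoint.mono_right hNL ?_) fun x hx => by simp [hpK x hx]
    rw [Submodule.disjoint_def]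
    intro x hx hxL
    rw [Submodule.mem_comap, hpL x hxL] at hx
    exact Submodule.disjoint_def.1 hL.prop x hxL hx
  have hrange : LinearMap.range p ≤ L := by
    refine hL.le_of_ge ?_ fun x hx => ⟨x, hpL x hx⟩
    rw [Submodule.disjoint_def]
    rintro _ ⟨x, rfl⟩ hx
    exact hpK x (hcomap hx)
  refine ⟨L, K, hNL, hN'K, hL.prop, codisjoint_iff.2 (eq_top_iff.2 fun x _ => ?_)⟩
  have hx : p x ∈ L := hrange ⟨x, rfl⟩
  refine Submodule.mem_sup.2 ⟨p x, hx, x - p x, hcomap ?_, by simp⟩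
  simp [hpL _ hx]

/-- A module is uniform if its nonzero submodules meet pairwise. The zero module counts as
uniform. -/
def IsUniformModule (S : Type u) [Ring S] (F : Type v) [AddCommGroup F] [Module S F] : Prop :=
  ∀ N N' : Submodule S F, Disjoint N N' → N = ⊥ ∨ N' = ⊥

theorem eq_bot_or_eq_bot_of_isCompl {F : ModuleCat.{v} S} (hF : Indecomposable F)
    {L K : Submodule S F} (h : IsCompl L K) : L = ⊥ ∨ K = ⊥ := by
  have e : F ≅ ModuleCat.of S L ⊞ ModuleCat.of S K :=
    (L.prodEquivOfIsCompl K h).symm.toModuleIso ≪≫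
      (ModuleCat.biprodIsoProd (ModuleCat.of S L) (ModuleCat.of S K)).symm
  refine (hF.2 _ _ e).imp (fun hz => ?_) (fun hz => ?_)
  all_goals
    have := ModuleCat.subsingleton_of_isZero hz
    exact Submodule.subsingleton_iff_eq_bot.1 this

theorem isUniformModule_of_indecomposable_injective {F : ModuleCat.{v} S}
    [Module.Injective S F] (hF : Indecomposable F) : IsUniformModule S F := fun N N' h => by
  obtain ⟨L, K, hNL, hN'K, hLK⟩ := Submodule.exists_isCompl_of_disjoint h
  exact (eq_bot_or_eq_bot_of_isCompl hF hLK).imp (fun h => le_bot_iff.1 (hNL.trans h.le))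
    (fun h => le_bot_iff.1 (hN'K.trans h.le))

theorem IsUniformModule.exists_eq_bot_of_finsetInf_eq_bot {F : Type v} [AddCommGroup F] [Module S F]
    [Nontrivial F] (hF : IsUniformModule S F) {ι : Type*} (s : Finset ι) (N : ι → Submodule S F)
    (h : s.inf N = ⊥) : ∃ i ∈ s, N i = ⊥ := by
  classical
  induction s using Finset.induction_on with
  | empty => exact absurd h top_ne_bot
  | insert a s _ ih =>
    rw [Finset.inf_insert] at h
    rcases hF _ _ (disjoint_iff.2 h) with h | h
    · exact ⟨a, by simp, h⟩
    · obtain ⟨i, hi, h⟩ := ih h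
      exact ⟨i, by simp [hi], h⟩

end Uniform

/-! ### Embeddings of an injective module -/

section Embedding

variable {S : Type u} [Ring S] {F M : Type v} [AddCommGroup F] [Module S F]
  [AddCommGroup M] [Module S M]

theorem exists_leftInverse_of_injective_module [Module.Injective S F] {i : F →ₗ[S] M}
    (hi : Function.Injective i) : ∃ r : M →ₗ[S] F, ∀ x, r (i x) = x :=
  Module.Injective.out i hi LinearMap.id

/-- `M` has no direct summand isomorphic to the injective module `F` if and only if `F` does not
embed in `M`. -/
theorem isEmpty_summand_equiv_iff [Module.Injective S F] :
    (∀ N N' : Submodule S M, IsCompl N N' → IsEmpty (N ≃ₗ[S] F)) ↔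
      ∀ i : F →ₗ[S] M, ¬ Function.Injective i := by
  constructor
  · intro h i hi
    obtain ⟨r, hr⟩ := exists_leftInverse_of_injective_module hi
    have hc : IsCompl (LinearMap.range i) (LinearMap.ker (i.rangeRestrict ∘ₗ r)) := by
      refine LinearMap.isCompl_of_proj ?_
      rintro ⟨_, x, rfl⟩
      ext
      simp [hr]
    exact (h _ _ hc).false (LinearEquiv.ofInjective i hi).symm
  · refine fun h N N' _ => ⟨fun e => h (N.subtype ∘ₗ e.symm.toLinearMap) ?_⟩
    exact N.subtype_injective.comp e.symm.injective

/-- A uniform module which embeds in a direct sum of copies of `M` embeds in `M`. -/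
theorem exists_injective_of_injective_finsupp [Nontrivial F] (hF : IsUniformModule S F)
    {I : Type*} {i : F →ₗ[S] I →₀ M} (hi : Function.Injective i) :
    ∃ j : F →ₗ[S] M, Function.Injective j := by
  obtain ⟨x, hx⟩ := exists_ne (0 : F)
  let N : I → Submodule S F := fun a => LinearMap.ker (Finsupp.lapply a ∘ₗ i)
  -- No nonzero multiple of `x` vanishes at all coordinates in the support of `i x`.
  have hdisj : Disjoint ((i x).support.inf N) (Submodule.span S {x}) := by
    rw [Submodule.disjoint_def]
    intro y hy hyx
    obtain ⟨s, rfl⟩ := Submodule.mem_span_singleton.1 hyx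
    refine (map_eq_zero_iff i hi).1 (Finsupp.ext fun a => ?_)
    by_cases ha : a ∈ (i x).support
    · simpa [N] using (Submodule.mem_finsetInf.1 hy) a ha
    · simp [Finsupp.notMem_support_iff.1 ha]
  have hbot := (hF _ _ hdisj).resolve_right (by simpa using hx)
  obtain ⟨a, -, ha⟩ := hF.exists_eq_bot_of_finsetInf_eq_bot _ _ hbot
  exact ⟨_, LinearMap.ker_eq_bot.1 ha⟩

end Embedding

/-! ### Cardinalities -/

theorem Cardinal.mk_lt_of_forall_mem_finset {α : Type*} {ι : Type*} (c : Cardinal)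
    (hc : Cardinal.aleph0 ≤ c) (s : Finset ι) (E : ι → Set α)
    (h : ∀ i ∈ s, Cardinal.mk (E i) < c) : Cardinal.mk (⋃ i ∈ s, E i : Set α) < c := by
  classical
  induction s using Finset.induction_on with
  | empty => simpa using Cardinal.aleph0_pos.trans_le hc
  | insert a s _ ih =>
    rw [Finset.set_biUnion_insert]
    exact (Cardinal.mk_union_le _ _).trans_lt (Cardinal.add_lt_of_lt hc (h a (by simp))
      (ih fun i hi => h i (by simp [hi])))

/-- A family of finitely supported functions indexed by a set smaller than the uncountable `I`
vanishes at all but fewer than `|I|` points. -/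
theorem Cardinal.mk_exists_ne_zero_lt {M N I : Type v} [Zero N] (φ : M → I →₀ N)
    (hI : Cardinal.aleph0 < Cardinal.mk I) (hM : Cardinal.mk M < Cardinal.mk I) :
    Cardinal.mk {a : I // ∃ x, φ x a ≠ 0} < Cardinal.mk I := by
  have hsub : {a : I | ∃ x, φ x a ≠ 0} = ⋃ x, ((φ x).support : Set I) := by
    ext a
    simp
  change Cardinal.mk {a : I | ∃ x, φ x a ≠ 0} < _
  rw [hsub]
  refine (Cardinal.mk_iUnion_le _).trans_lt (Cardinal.mul_lt_of_lt hI.le hM ?_)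
  exact (ciSup_le' fun x => ((φ x).support.finite_toSet.lt_aleph0).le).trans_lt hI

/-! ### Rank -/

section RankLemmas

variable {R : Type u} [Ring R] {F : ModuleCat.{v} Rᵐᵒᵖ}

theorem HasRank.not_injective_of_zero [Module.Injective Rᵐᵒᵖ F]
    {M : ModuleCat.{v} Rᵐᵒᵖ} (h : HasRank F M 0)
    (i : F →ₗ[Rᵐᵒᵖ] M) : ¬ Function.Injective i := by
  obtain ⟨M₁, M₂, hc, ⟨e⟩, h⟩ := h
  have : IsEmpty (0 : Cardinal.{v}).out := Cardinal.mk_eq_zero_iff.1 (Cardinal.mk_out 0)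
  have : Subsingleton M₁ := e.toEquiv.subsingleton
  have hM₁ : M₁ = ⊥ := Submodule.subsingleton_iff_eq_bot.1 this
  have hM₂ : M₂ = ⊤ := by simpa [hM₁] using hc.sup_eq_top
  intro hi
  refine isEmpty_summand_equiv_iff.1 h (i.codRestrict M₂ fun x => by simp [hM₂]) fun x y hxy => ?_
  exact hi (congrArg Subtype.val hxy)

theorem HasRank.exists_injective {M : ModuleCat.{v} Rᵐᵒᵖ} {κ : Cardinal.{v}} (h : HasRank F M κ)
    (hκ : 0 < κ) : ∃ i : F →ₗ[Rᵐᵒᵖ] M, Function.Injective i := by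
  obtain ⟨M₁, M₂, -, ⟨e⟩, -⟩ := h
  obtain ⟨a⟩ : Nonempty κ.out := by
    rw [← Cardinal.mk_ne_zero_iff, Cardinal.mk_out]
    exact hκ.ne'
  exact ⟨M₁.subtype ∘ₗ e.symm.toLinearMap ∘ₗ Finsupp.lsingle a,
    M₁.subtype_injective.comp (e.symm.injective.comp (Finsupp.single_injective a))⟩

theorem hasRank_one_prod [Module.Injective Rᵐᵒᵖ F] {N : Type v} [AddCommGroup N] [Module Rᵐᵒᵖ N]
    (hN : ∀ i : F →ₗ[Rᵐᵒᵖ] N, ¬ Function.Injective i) :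
    HasRank F (ModuleCat.of Rᵐᵒᵖ (F × N)) 1 := by
  obtain ⟨_, ⟨a⟩⟩ := Cardinal.eq_one_iff_unique.1 (Cardinal.mk_out (1 : Cardinal.{v}))
  refine ⟨LinearMap.range (LinearMap.inl Rᵐᵒᵖ F N), LinearMap.range (LinearMap.inr Rᵐᵒᵖ F N),
    LinearMap.isCompl_range_inl_inr, ⟨?_⟩, isEmpty_summand_equiv_iff.2 fun i hi => ?_⟩
  · exact (LinearEquiv.ofInjective _ LinearMap.inl_injective).symm ≪≫ₗ
      (Finsupp.uniqueLinearEquiv Rᵐᵒᵖ F a).symm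
  · let e := LinearEquiv.ofInjective (LinearMap.inr Rᵐᵒᵖ F N) LinearMap.inr_injective
    exact hN (e.symm.toLinearMap ∘ₗ i) (e.symm.injective.comp hi)

end RankLemmas

/-! ### The order on modules of finite rank -/

section Order

variable {R : Type u} [Ring R] {F : ModuleCat.{v} Rᵐᵒᵖ}

/-- If `f ∘ g = 1` on a module `M` containing `F`, with `g : M → A` and `f : A → M`, then `f` is
nonzero on every summand of `A` whose complement does not contain `F`. -/
theorem exists_ne_zero_of_leftInverse {M A : Type v} [AddCommGroup M] [Module Rᵐᵒᵖ M]
    [AddCommGroup A] [Module Rᵐᵒᵖ A] {i : F →ₗ[Rᵐᵒᵖ] M} (hi : Function.Injective i)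
    {A₁ A₂ : Submodule Rᵐᵒᵖ A} (hc : IsCompl A₁ A₂)
    (hA₂ : ∀ j : F →ₗ[Rᵐᵒᵖ] A₂, ¬ Function.Injective j)
    {f : A →ₗ[Rᵐᵒᵖ] M} {g : M →ₗ[Rᵐᵒᵖ] A} (hfg : ∀ x, f (g x) = x) : ∃ a ∈ A₁, f a ≠ 0 := by
  by_contra! hf
  let q : A →ₗ[Rᵐᵒᵖ] A₂ := A₂.projectionOnto A₁ hc.symm
  have hq : ∀ a, f (q a) = f a := fun a => by
    have hmem : a - q a ∈ A₁ := by
      rw [← Submodule.ker_projectionOnto hc.symm, LinearMap.mem_ker, map_sub,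
        Submodule.projectionOnto_apply_left, sub_self]
    exact (sub_eq_zero.1 ((map_sub f _ _).symm.trans (hf _ hmem))).symm
  refine hA₂ (q ∘ₗ g ∘ₗ i) fun x y hxy => hi ?_
  rw [← hfg (i x), ← hfg (i y), ← hq, ← hq (g (i y))]
  exact congrArg (fun z : A₂ => f z) hxy

theorem not_prec_of_injective [Module.Injective Rᵐᵒᵖ F] {M A : FiniteRankCat F}
    {i : F →ₗ[Rᵐᵒᵖ] M.obj}
    (hi : Function.Injective i) : ¬ Prec M A := by
  rintro ⟨E, hE, hE1, hlt⟩
  obtain ⟨κ, hκ, A₁, A₂, hc, ⟨e⟩, hA₂⟩ := A.property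
  rw [isEmpty_summand_equiv_iff] at hA₂
  have : Finite κ.out := by
    rw [← Cardinal.mk_lt_aleph0_iff, Cardinal.mk_out]
    exact hκ
  have := Fintype.ofFinite κ.out
  obtain ⟨r, hr⟩ := exists_leftInverse_of_injective_module hi
  -- `φ k` is the retraction `M → F` followed by the embedding as the `k`-th copy of `F` in `A`.
  let φ : κ.out → (M ⟶ A) := fun k => ObjectProperty.homMk (ModuleCat.ofHom
    (A₁.subtype ∘ₗ e.symm.toLinearMap ∘ₗ Finsupp.lsingle k ∘ₗ r))
  have hcover : E ⊆ ⋃ k ∈ (Finset.univ : Finset κ.out), {p | p ∈ E ∧ φ k ≫ p.1 ≠ 0} := by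
    intro p hp
    by_contra hno
    simp only [Finset.mem_univ, Set.iUnion_true, Set.mem_iUnion, Set.mem_ofPred_eq, not_exists,
      not_and, not_not] at hno
    have hfg : ∀ x, p.1.hom.hom (p.2.hom.hom x) = x := fun x =>
      congrArg (fun u : M ⟶ M => u.hom.hom x) (hE1 p hp)
    obtain ⟨a, ha, hpa⟩ := exists_ne_zero_of_leftInverse hi hc hA₂ hfg
    have hzero : p.1.hom.hom ∘ₗ A₁.subtype ∘ₗ e.symm.toLinearMap = 0 := by
      refine Finsupp.lhom_ext fun k y => ?_
      have := congrArg (fun u : M ⟶ M => u.hom.hom (i y)) (hno k hp)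
      simpa [φ, hr] using this
    refine hpa ?_
    simpa using LinearMap.congr_fun hzero (e ⟨a, ha⟩)
  have hinf : Cardinal.aleph0 ≤ Cardinal.mk E := by
    have := hE.to_subtype
    exact Cardinal.aleph0_le_mk E
  exact ((Cardinal.mk_le_mk_of_subset hcover).trans_lt
    (Cardinal.mk_lt_of_forall_mem_finset _ hinf _ _ fun k _ => hlt (φ k))).false

theorem exists_prec_of_hasRank_zero [Module.Injective Rᵐᵒᵖ F]
    (hF : IsUniformModule Rᵐᵒᵖ F) [Nontrivial F]
    (M : FiniteRankCat F) (hM : HasRank F M.obj 0) [Nontrivial M.obj] :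
    ∃ A : FiniteRankCat F, HasRank F A.obj 1 ∧ Prec M A := by
  -- Any index set `I` that is uncountable and larger than `M` will do.
  let c : Cardinal.{v} := Order.succ (max Cardinal.aleph0 (Cardinal.mk M.obj))
  let I : Type v := c.out
  have hIc : Cardinal.mk I = Order.succ (max Cardinal.aleph0 (Cardinal.mk M.obj)) :=
    Cardinal.mk_out c
  have hI : Cardinal.aleph0 < Cardinal.mk I := by
    rw [hIc, Order.lt_succ_iff]
    exact le_max_left _ _
  have hMI : Cardinal.mk M.obj < Cardinal.mk I := by
    rw [hIc, Order.lt_succ_iff]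
    exact le_max_right _ _
  have hrank : HasRank F (ModuleCat.of Rᵐᵒᵖ (F × (I →₀ M.obj))) 1 :=
    hasRank_one_prod fun i hi => by
      obtain ⟨j, hj⟩ := exists_injective_of_injective_finsupp hF hi
      exact hM.not_injective_of_zero j hj
  let A : FiniteRankCat F := ⟨_, 1, Cardinal.one_lt_aleph0, hrank⟩
  let π : I → (A ⟶ M) := fun k => ObjectProperty.homMk (ModuleCat.ofHom
    (Finsupp.lapply k ∘ₗ LinearMap.snd Rᵐᵒᵖ F (I →₀ M.obj)))
  let ε : I → (M ⟶ A) := fun k => ObjectProperty.homMk (ModuleCat.ofHom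
    (LinearMap.inr Rᵐᵒᵖ F (I →₀ M.obj) ∘ₗ Finsupp.lsingle k))
  have hε : Function.Injective fun k => (π k, ε k) := by
    intro k l hkl
    obtain ⟨x, hx⟩ := exists_ne (0 : M.obj)
    have h : (Finsupp.single k x : I →₀ M.obj) = Finsupp.single l x :=
      congrArg (fun u : M ⟶ A => (u.hom.hom x : F × (I →₀ M.obj)).2) (congrArg Prod.snd hkl)
    exact Finsupp.single_left_injective hx h
  have hcard : Cardinal.mk (Set.range fun k => (π k, ε k)) = Cardinal.mk I :=
    Cardinal.mk_range_eq _ hε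
  refine ⟨A, hrank, Set.range fun k => (π k, ε k), ?_, ?_, fun φ => ?_⟩
  · have : Infinite I := Cardinal.infinite_iff.2 hI.le
    exact Set.infinite_range_of_injective hε
  · rintro _ ⟨k, rfl⟩
    refine ObjectProperty.hom_ext _ (ModuleCat.hom_ext (LinearMap.ext fun x => ?_))
    exact Finsupp.single_eq_same
  · rw [hcard]
    let ψ : M.obj → I →₀ M.obj := fun x => (φ.hom.hom x : F × (I →₀ M.obj)).2
    have hcover : {p : (A ⟶ M) × (M ⟶ A) | p ∈ Set.range (fun k => (π k, ε k)) ∧ φ ≫ p.1 ≠ 0} ⊆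
        (fun k => (π k, ε k)) '' {k | ∃ x, ψ x k ≠ 0} := by
      rintro _ ⟨⟨k, rfl⟩, hk⟩
      refine ⟨k, ?_, rfl⟩
      by_contra hno
      simp only [Set.mem_ofPred_eq, not_exists, not_not] at hno
      exact hk (ObjectProperty.hom_ext _ (ModuleCat.hom_ext (LinearMap.ext hno)))
    exact (Cardinal.mk_le_mk_of_subset hcover).trans_lt
      (Cardinal.mk_image_le.trans_lt (Cardinal.mk_exists_ne_zero_lt ψ hI hMI))

theorem maximalObjects_of_hasRank [Module.Injective Rᵐᵒᵖ F] {M : FiniteRankCat F}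
    {κ : Cardinal.{v}} (hκ : 0 < κ) (h : HasRank F M.obj κ) :
    maximalObjects (FiniteRankCat F) M := by
  obtain ⟨i, hi⟩ := h.exists_injective hκ
  rintro ⟨A, hA⟩
  exact not_prec_of_injective hi hA

theorem not_prec_of_subsingleton {M A : FiniteRankCat F} [Subsingleton M.obj] : ¬ Prec M A := by
  rintro ⟨E, hE, -, -⟩
  have : Subsingleton ((A ⟶ M) × (M ⟶ A)) := by
    refine ⟨fun p q => Prod.ext ?_ ?_⟩ <;>
      refine ObjectProperty.hom_ext _ (ModuleCat.hom_ext (LinearMap.ext fun x => ?_))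
    · exact Subsingleton.elim (α := M.obj) _ _
    · rw [Subsingleton.elim (α := M.obj) x 0, map_zero, map_zero]
  exact hE E.toFinite

/-- A module of finite rank that is neither zero nor of positive rank has rank `0`. -/
theorem hasRank_zero_of_not_pos {M : FiniteRankCat F}
    (h : ¬ ∃ κ : Cardinal.{v}, 0 < κ ∧ HasRank F M.obj κ) : HasRank F M.obj 0 := by
  obtain ⟨κ, -, hκ⟩ := M.property
  rcases eq_zero_or_pos κ with rfl | hpos
  · exact hκ
  · exact absurd ⟨κ, hpos, hκ⟩ h

end Order

theorem mainTheorem8 {R : Type u} [Ring R] [Small.{v} R] [IsNoetherianRing Rᵐᵒᵖ]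
    (F : ModuleCat.{v} Rᵐᵒᵖ) (hFinj : Injective F) (hFind : Indecomposable F) :
    (∀ M : FiniteRankCat F, maximalObjects (FiniteRankCat F) M ↔
      (∃ κ : Cardinal.{v}, 0 < κ ∧ HasRank F M.obj κ) ∨ Subsingleton M.obj) ∧
    (∀ M : FiniteRankCat F, belowMaximalObjects (FiniteRankCat F) M ↔
      HasRank F M.obj 0 ∧ Nontrivial M.obj) := by
  have : Module.Injective Rᵐᵒᵖ F := Module.injective_module_of_injective_object Rᵐᵒᵖ F
  have : Nontrivial F := by
    by_contra h
    rw [not_nontrivial_iff_subsingleton] at h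
    exact hFind.1 (ModuleCat.isZero_of_subsingleton F)
  have hunif := isUniformModule_of_indecomposable_injective hFind
  have hmax : ∀ M : FiniteRankCat F, maximalObjects (FiniteRankCat F) M ↔
      (∃ κ : Cardinal.{v}, 0 < κ ∧ HasRank F M.obj κ) ∨ Subsingleton M.obj := by
    refine fun M => ⟨fun hM => ?_, ?_⟩
    · by_contra! h
      obtain ⟨hpos, hnontriv⟩ := h
      obtain ⟨A, -, hA⟩ := exists_prec_of_hasRank_zero hunif M
        (hasRank_zero_of_not_pos fun ⟨κ, h0, hκ⟩ => hpos κ h0 hκ)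
      exact hM ⟨A, hA⟩
    · rintro (⟨κ, hκ, h⟩ | _)
      · exact maximalObjects_of_hasRank hκ h
      · exact fun ⟨A, hA⟩ => not_prec_of_subsingleton hA
  refine ⟨hmax, fun M => ⟨?_, ?_⟩⟩
  · rintro ⟨A, -, hA⟩
    have hM := mt (hmax M).2 fun h => h ⟨A, hA⟩
    rw [not_or, not_subsingleton_iff_nontrivial] at hM
    exact ⟨hasRank_zero_of_not_pos hM.1, hM.2⟩
  · rintro ⟨hM, _⟩
    obtain ⟨A, hrank, hA⟩ := exists_prec_of_hasRank_zero hunif M hM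
    exact ⟨A, maximalObjects_of_hasRank zero_lt_one hrank, hA⟩
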